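/- Let $N \ge 1$, $\sigma > 0$, and consider the channel $\mathbf{Y} = \mathbf{X} + \mathbf{N}$, where the input $\mathbf{X}$ and the noise $\mathbf{N}$ are independent random vectors in $\mathbb{R}^N$ and $\mathbf{N}$ is Gaussian with mean $0$ and covariance matrix $\sigma^2 I_N$. Let $\mathbf{X}$ have the $N$-dimensional multisphere distribution with radii $s_1,\dots,s_K \ge 0$ and probabilities $p_1,\dots,p_K \ge 0$, $\sum_{k=1}^K p_k = 1$; that is, the law of $\mathbf{X}$ is $\sum_{k=1}^K p_k\, U_{s_k}$, where $U_s$ is the uniform distribution on the hypersphere of radius $s$ centered at the origin (a point mass at the origin if $s=0$). Let $I(\mathbf{X};\mathbf{Y}) = h(\mathbf{Y}) - h(\mathbf{Y}\mid\mathbf{X})$ be the mutual information in bits, where $h(\mathbf{Y}) = -\int f_{\mathbf{Y}} \log_2 f_{\mathbf{Y}}\,\mathrm{d}\mathbf{y}$ is the differential entropy and $h(\mathbf{Y}\mid\mathbf{X})$ is the average over $\mathbf{X}$ of the differential entropy of the conditional law of $\mathbf{Y}$ given $\mathbf{X}$. Define, for $\tilde r > 0$ and $\tilde s > 0$, $$\chi(\tilde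 r,\tilde s) = \frac{\tilde r^{N/2}}{\tilde s^{N/2-1}} \exp\!\left(-\frac{\tilde r^2+\tilde s^2}{2}\right) I_{N/2-1}(\tilde r\tilde s), \qquad \chi(\tilde r, 0) = \lim_{\tilde s \to 0^+} \chi(\tilde r,\tilde s) = \frac{\tilde r^{N-1}}{2^{N/2-1}\,\Gamma(N/2)}\, e^{-\tilde r^2/2},$$ where $I_\nu(u) = \sum_{m=0}^\infty \frac{(u/2)^{2m+\nu}}{m!\,\Gamma(m+\nu+1)}$ is the modified Bessel function of the first kind of order $\nu$. Then $\tilde R = \|\mathbf{Y}\|/\sigma$ has on $(0,\infty)$ the probability density $$f_{\tilde R}(\tilde r) = \sum_{k=1}^K p_k\, \chi\!\left(\tilde r, \frac{s_k}{\sigma}\right),$$ the entropies $h(\mathbf{Y})$ and $h(\mathbf{Y}\mid\mathbf{X})$ exist and are finite, and $$I(\mathbf{X};\mathbf{Y}) = -\int_0^\infty f_{\tilde R}(\tilde r) \log_2 \frac{f_{\tilde R}(\tilde r)}{\tilde r^{N-1}}\,\mathrm{d}\tilde r + \log_2 \frac{2}{\Gamma(N/2)} - \frac{N}{2}\log_2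 (2e),$$ where the integral converges absolutely. -/

import Mathlib

open MeasureTheory ProbabilityTheory Set
open scoped ENNReal

namespace Multisphere

noncomputable section

/-- The uniform probability distribution on the hypersphere of radius `s` centered at the origin of
`ℝ^N`: the normalized surface measure of the unit sphere, transported by `u ↦ s • u`. -/
def sphereUniform (N : ℕ) (s : ℝ) : Measure (EuclideanSpace ℝ (Fin N)) :=
  (((volume : Measure (EuclideanSpace ℝ (Fin N))).toSphere univ)⁻¹ •
    (volume : Measure (EuclideanSpace ℝ (Fin N))).toSphere).map
      (fun u : Metric.sphere (0 : EuclideanSpace ℝ (Fin N)) 1 =>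
        s • (u : EuclideanSpace ℝ (Fin N)))

/-- The `N`-dimensional multisphere distribution: the `k`-th sphere, of radius `s k`, is chosen with
probability `p k`, and the point is then uniform on that sphere. -/
def multisphere (N : ℕ) {K : ℕ} (p s : Fin K → ℝ) : Measure (EuclideanSpace ℝ (Fin N)) :=
  ∑ k : Fin K, ENNReal.ofReal (p k) • sphereUniform N (s k)

/-- The density with respect to Lebesgue measure of a measure on `ℝ^N`, as a real function. -/
def density {N : ℕ} (ν : Measure (EuclideanSpace ℝ (Fin N))) (y : EuclideanSpace ℝ (Fin N)) : ℝ :=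
  (ν.rnDeriv volume y).toReal

/-- The differential entropy, in bits, of a distribution on `ℝ^N`. -/
def diffEntropy {N : ℕ} (ν : Measure (EuclideanSpace ℝ (Fin N))) : ℝ :=
  -∫ y, density ν y * Real.logb 2 (density ν y)

/-- The differential entropy of `ν` is well defined and finite: `ν` has a density `f`, and
`f log₂ f` is integrable. -/
def HasDiffEntropy {N : ℕ} (ν : Measure (EuclideanSpace ℝ (Fin N))) : Prop :=
  ν ≪ volume ∧ Integrable (fun y => density ν y * Real.logb 2 (density ν y)) volume

/-- The conditional differential entropy `h(Y | X)`, in bits: the average over the law of `X` of the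
differential entropy of the conditional law of `Y` given `X = x`. -/
def condDiffEntropy {Ω : Type*} [MeasurableSpace Ω] {N : ℕ}
    (X Y : Ω → EuclideanSpace ℝ (Fin N)) (P : Measure Ω) [IsFiniteMeasure P] : ℝ :=
  ∫ x, diffEntropy (condDistrib Y X P x) ∂(P.map X)

/-- The conditional differential entropy `h(Y | X)` is well defined and finite. -/
def HasCondDiffEntropy {Ω : Type*} [MeasurableSpace Ω] {N : ℕ}
    (X Y : Ω → EuclideanSpace ℝ (Fin N)) (P : Measure Ω) [IsFiniteMeasure P] : Prop :=
  (∀ᵐ x ∂(P.map X), HasDiffEntropy (condDistrib Y X P x)) ∧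
    Integrable (fun x => diffEntropy (condDistrib Y X P x)) (P.map X)

/-- The mutual information `I(X; Y) = h(Y) - h(Y | X)`, in bits. -/
def mutualInfo {Ω : Type*} [MeasurableSpace Ω] {N : ℕ}
    (X Y : Ω → EuclideanSpace ℝ (Fin N)) (P : Measure Ω) [IsFiniteMeasure P] : ℝ :=
  diffEntropy (P.map Y) - condDiffEntropy X Y P

/-- The modified Bessel function of the first kind `I_ν(u)`, for `u > 0`, by its power series. -/
def besselI (ν u : ℝ) : ℝ :=
  ∑' m : ℕ, (u / 2) ^ (2 * (m : ℝ) + ν) / ((m.factorial : ℝ) * Real.Gamma ((m : ℝ) + ν + 1))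

/-- The noncentral chi density
`χ(r, s) = r^(N/2) / s^(N/2-1) * exp(-(r² + s²)/2) * I_{N/2-1}(r s)` in dimension `N`. At `s = 0`,
where this formula reads `0 / 0` in general, the value is the limit as `s → 0+`, which is the
(central) chi density. -/
def chi (N : ℕ) (r s : ℝ) : ℝ :=
  if s = 0 then
    r ^ ((N : ℝ) - 1) / (2 ^ ((N : ℝ) / 2 - 1) * Real.Gamma ((N : ℝ) / 2)) * Real.exp (-(r ^ 2) / 2)
  else
    r ^ ((N : ℝ) / 2) / s ^ ((N : ℝ) / 2 - 1) * Real.exp (-(r ^ 2 + s ^ 2) / 2) *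
      besselI ((N : ℝ) / 2 - 1) (r * s)

/-- The mixture `r ↦ ∑ k, p k * χ(r, s k / σ)`. -/
def radialDensity (N : ℕ) (σ : ℝ) {K : ℕ} (p s : Fin K → ℝ) (r : ℝ) : ℝ :=
  ∑ k : Fin K, p k * chi N r (s k / σ)

end

end Multisphere

namespace Multisphere

/-! The output density at `y` is the mean of the Gaussian kernel at `y - x` over the law of the
input (`conv_multivariateGaussian`). On a sphere of radius `s` the square `‖y - x‖ ^ 2` varies only
through the inner product of `y` and `x`, so this mean is a Gaussian factor times the moment
generating function of one coordinate of a uniform unit vector. Expanded in moments, that function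
is the Bessel series (`hasSum_integral_exp_inner`, `chi_eq`). Hence the density depends only on `r =
‖y‖ / σ` and equals the mixture of the `χ` divided by `S * r ^ (N - 1)`, with `S = sphereArea N σ`.

Polar coordinates turn integrals of functions of `r` against the output density into integrals
against the mixture (`integral_noisyDensity_mul_comp_norm`). Indicators give the law of the radius;
the logarithm of the density gives `h(Y)`, with the extra term `log₂ S`. Given the input, the output
is a translate of the noise, so `h(Y | X)` is the noise entropy. In the difference `π` and `σ`
cancel (`logb_sphereArea_sub`). Finiteness holds because a bounded input squeezes the output density
between two Gaussian functions. -/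

variable {N : ℕ} {σ : ℝ}

/-! ### Isotropic Gaussian law: density and second moment -/

/-- The density of the centered Gaussian distribution on `ℝ^N` with covariance `σ² I`. -/
noncomputable def gaussDensity {N : ℕ} (σ : ℝ) (y : EuclideanSpace ℝ (Fin N)) : ℝ :=
  ((√(2 * Real.pi) * σ) ^ N)⁻¹ * Real.exp (-‖y‖ ^ 2 / (2 * σ ^ 2))

lemma gaussDensity_pos (hσ : 0 < σ) (y : EuclideanSpace ℝ (Fin N)) : 0 < gaussDensity σ y := by
  unfold gaussDensity
  have := Real.pi_pos
  positivity

lemma continuous_gaussDensity : Continuous (gaussDensity (N := N) σ) := by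
  unfold gaussDensity
  fun_prop

lemma integrable_rexp_neg_mul_sq_norm {b : ℝ} (hb : 0 < b) :
    Integrable (fun y : EuclideanSpace ℝ (Fin N) => Real.exp (-b * ‖y‖ ^ 2)) := by
  have h := (GaussianFourier.integrable_cexp_neg_mul_sq_norm_add (V := EuclideanSpace ℝ (Fin N))
    (b := (b : ℂ)) (by simpa using hb) 0 0).re
  refine h.congr (.of_forall fun y => ?_)
  simp only [zero_mul, add_zero]
  have : (-(b : ℂ) * (‖y‖ : ℂ) ^ 2) = ((-b * ‖y‖ ^ 2 : ℝ) : ℂ) := by push_cast; ring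
  rw [this]
  exact Complex.exp_ofReal_re _

lemma integrable_gaussDensity (hσ : 0 < σ) : Integrable (gaussDensity (N := N) σ) := by
  have h := (integrable_rexp_neg_mul_sq_norm (N := N) (b := (2 * σ ^ 2)⁻¹) (by positivity)).const_mul
    (((√(2 * Real.pi) * σ) ^ N)⁻¹)
  refine h.congr (.of_forall fun y => ?_)
  simp only [gaussDensity]
  congr 2
  ring

lemma posSemidef_sq_smul_one :
    (σ ^ 2 • (1 : Matrix (Fin N) (Fin N) ℝ)).PosSemidef :=
  Matrix.PosSemidef.one.smul (sq_nonneg σ)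

/-- Finite measures are determined by their characteristic functions, and that of the right side is
an explicit Gaussian Fourier integral. -/
lemma multivariateGaussian_eq_withDensity (hσ : 0 < σ) :
    multivariateGaussian 0 (σ ^ 2 • (1 : Matrix (Fin N) (Fin N) ℝ)) =
      (volume : Measure (EuclideanSpace ℝ (Fin N))).withDensity
        (fun y => ENNReal.ofReal (gaussDensity σ y)) := by
  have hfin := isFiniteMeasure_withDensity_ofReal (integrable_gaussDensity (N := N) hσ).2
  refine Measure.ext_of_charFun (funext fun t => ?_)
  rw [charFun_multivariateGaussian posSemidef_sq_smul_one, charFun_apply,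
    integral_withDensity_eq_integral_toReal_smul
      (continuous_gaussDensity.measurable.ennreal_ofReal) (by simp)]
  have hint : ∀ x : EuclideanSpace ℝ (Fin N),
      (ENNReal.ofReal (gaussDensity σ x)).toReal • Complex.exp (inner ℝ x t * Complex.I) =
      (((√(2 * Real.pi) * σ) ^ N)⁻¹ : ℝ) *
        Complex.exp (-((2 * σ ^ 2)⁻¹ : ℝ) * ‖x‖ ^ 2 + Complex.I * inner ℝ t x) := by
    intro x
    rw [ENNReal.toReal_ofReal (gaussDensity_pos hσ x).le, gaussDensity, real_inner_comm,
      Complex.real_smul, Complex.exp_add, Complex.ofReal_mul, Complex.ofReal_exp, mul_assoc]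
    congr 3
    · push_cast; ring_nf
    · ring_nf
  simp_rw [hint]
  rw [integral_const_mul, GaussianFourier.integral_cexp_neg_mul_sq_norm_add
    (by rw [Complex.ofReal_re]; positivity), finrank_euclideanSpace, Fintype.card_fin]
  -- The complex power produced by the Fourier integral has a positive real base, so it is a real
  -- power: the normalizing constant.
  have hpow : ((Real.pi : ℂ) / ((2 * σ ^ 2)⁻¹ : ℝ)) ^ ((N : ℂ) / 2) =
      (((√(2 * Real.pi) * σ) ^ N : ℝ) : ℂ) := by
    have h1 : (Real.pi : ℂ) / ((2 * σ ^ 2)⁻¹ : ℝ) = ((2 * Real.pi * σ ^ 2 : ℝ) : ℂ) := by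
      push_cast; rw [div_inv_eq_mul]; ring
    have h2 : ((N : ℂ) / 2) = ((N / 2 : ℝ) : ℂ) := by push_cast; ring
    have hpi := Real.pi_pos
    rw [h1, h2, ← Complex.ofReal_cpow (by positivity)]
    congr 1
    rw [show (N : ℝ) / 2 = (1 / 2) * (N : ℝ) by ring, Real.rpow_mul (by positivity),
      Real.rpow_natCast, ← Real.sqrt_eq_rpow, Real.sqrt_mul (by positivity),
      Real.sqrt_sq hσ.le]
  rw [hpow, ← mul_assoc, ← Complex.ofReal_mul, inv_mul_cancel₀
    (by have := Real.pi_pos; positivity), Complex.ofReal_one, one_mul, inner_zero_right]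
  congr 1
  have hdot : (t.ofLp ⬝ᵥ (σ ^ 2 • (1 : Matrix (Fin N) (Fin N) ℝ)).mulVec t.ofLp) =
      σ ^ 2 * ‖t‖ ^ 2 := by
    rw [Matrix.smul_mulVec, Matrix.one_mulVec, dotProduct_smul, EuclideanSpace.real_norm_sq_eq]
    simp [dotProduct, pow_two]
  rw [hdot]
  have : (σ : ℂ) ≠ 0 := by exact_mod_cast hσ.ne'
  simp only [Complex.I_sq]
  push_cast
  field_simp
  ring

lemma integral_multivariateGaussian (hσ : 0 < σ) (f : EuclideanSpace ℝ (Fin N) → ℝ) :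
    ∫ y, f y ∂(multivariateGaussian 0 (σ ^ 2 • (1 : Matrix (Fin N) (Fin N) ℝ))) =
      ∫ y, gaussDensity σ y * f y := by
  rw [multivariateGaussian_eq_withDensity hσ, integral_withDensity_eq_integral_toReal_smul
      (continuous_gaussDensity.measurable.ennreal_ofReal) (by simp)]
  simp [ENNReal.toReal_ofReal (gaussDensity_pos hσ _).le]

lemma integral_gaussDensity (hσ : 0 < σ) :
    ∫ y : EuclideanSpace ℝ (Fin N), gaussDensity σ y = 1 := by
  simpa using (integral_multivariateGaussian (N := N) hσ (fun _ => 1)).symm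

/-- The squared norm is a sum over coordinates, and each coordinate contributes its variance `σ ^
2`. -/
lemma integral_gaussDensity_mul_sq_norm (hσ : 0 < σ) :
    ∫ y : EuclideanSpace ℝ (Fin N), gaussDensity σ y * ‖y‖ ^ 2 = N * σ ^ 2 := by
  rw [← integral_multivariateGaussian hσ]
  have hlp (i : Fin N) := (measurePreserving_eval_multivariateGaussian (i := i) (μ := 0)
    (posSemidef_sq_smul_one (N := N) (σ := σ)))
  simp_rw [EuclideanSpace.real_norm_sq_eq]
  rw [integral_finsetSum]
  · have (i : Fin N) : ∫ y : EuclideanSpace ℝ (Fin N), y i ^ 2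
        ∂(multivariateGaussian 0 (σ ^ 2 • (1 : Matrix (Fin N) (Fin N) ℝ))) = σ ^ 2 := by
      have h := variance_eval_multivariateGaussian (i := i) (μ := 0)
        (posSemidef_sq_smul_one (N := N) (σ := σ))
      rw [variance_of_integral_eq_zero (by fun_prop)] at h
      · simpa using h
      · rw [← integral_map (φ := fun y : EuclideanSpace ℝ (Fin N) => y i) (f := fun x => x)
          (by fun_prop) (by fun_prop), (hlp i).map_eq, integral_id_gaussianReal]
        simp
    simp [this]
  · intro i _
    have := (hlp i).integrable_comp_of_integrable (g := fun x => x ^ 2)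
      ((memLp_id_gaussianReal 2).integrable_sq)
    exact this

lemma map_inner_stdGaussian (e : EuclideanSpace ℝ (Fin N)) (he : ‖e‖ = 1) :
    (stdGaussian (EuclideanSpace ℝ (Fin N))).map (fun x => inner ℝ e x) = gaussianReal 0 1 := by
  have h := IsGaussian.map_eq_gaussianReal (μ := stdGaussian (EuclideanSpace ℝ (Fin N)))
    (innerSL ℝ e)
  rw [integral_strongDual_stdGaussian, variance_dual_stdGaussian] at h
  simpa [he] using h

/-! ### Differential entropy of laws given by a density -/

lemma density_withDensity {f : EuclideanSpace ℝ (Fin N) → ℝ} (hf : Measurable f)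
    (hf0 : ∀ y, 0 ≤ f y) :
    density (volume.withDensity (fun y => ENNReal.ofReal (f y))) =ᵐ[volume] f := by
  filter_upwards [Measure.rnDeriv_withDensity volume hf.ennreal_ofReal] with y hy
  rw [density, hy, ENNReal.toReal_ofReal (hf0 y)]

lemma density_mul_logb_withDensity {f : EuclideanSpace ℝ (Fin N) → ℝ} (hf : Measurable f)
    (hf0 : ∀ y, 0 ≤ f y) :
    (fun y => density (volume.withDensity (fun y => ENNReal.ofReal (f y))) y *
      Real.logb 2 (density (volume.withDensity (fun y => ENNReal.ofReal (f y))) y)) =ᵐ[volume]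
      fun y => f y * Real.logb 2 (f y) := by
  filter_upwards [density_withDensity hf hf0] with y hy
  rw [hy]

lemma diffEntropy_withDensity {f : EuclideanSpace ℝ (Fin N) → ℝ} (hf : Measurable f)
    (hf0 : ∀ y, 0 ≤ f y) :
    diffEntropy (volume.withDensity (fun y => ENNReal.ofReal (f y))) =
      -∫ y, f y * Real.logb 2 (f y) := by
  rw [diffEntropy, integral_congr_ae (density_mul_logb_withDensity hf hf0)]

lemma hasDiffEntropy_withDensity {f : EuclideanSpace ℝ (Fin N) → ℝ} (hf : Measurable f)
    (hf0 : ∀ y, 0 ≤ f y) (hint : Integrable (fun y => f y * Real.logb 2 (f y))) :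
    HasDiffEntropy (volume.withDensity (fun y => ENNReal.ofReal (f y))) :=
  ⟨withDensity_absolutelyContinuous _ _, hint.congr (density_mul_logb_withDensity hf hf0).symm⟩

/-- A density squeezed between two Gaussian functions has finite differential entropy. -/
lemma integrable_mul_logb_of_gaussian_bounds {f : EuclideanSpace ℝ (Fin N) → ℝ}
    (hf : Measurable f) {a b A c : ℝ} (ha : 0 < a) (hb : 0 ≤ b) (hc : 0 < c)
    (hlow : ∀ y, a * Real.exp (-b * ‖y‖ ^ 2) ≤ f y)
    (hup : ∀ y, f y ≤ A * Real.exp (-c * ‖y‖ ^ 2)) :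
    Integrable (fun y => f y * Real.logb 2 (f y)) := by
  have hpos y : 0 < f y := (by positivity : 0 < a * Real.exp (-b * ‖y‖ ^ 2)).trans_le (hlow y)
  have hA : 0 < A := by
    have := (hpos 0).trans_le (hup 0)
    exact pos_of_mul_pos_left this (Real.exp_pos _).le
  have hlog2 : 0 < Real.log 2 := Real.log_pos one_lt_two
  set M := |Real.log a| + |Real.log A| with hM
  have hM0 : 0 ≤ M := by positivity
  -- `|log f|` grows at most linearly in `‖y‖ ^ 2`; half of the decay rate `c` absorbs this growth
  -- and the other half keeps the bound integrable.
  refine ((integrable_rexp_neg_mul_sq_norm (N := N) (b := c / 2) (by positivity)).const_mul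
    (A * (M + b * (2 / c)) / Real.log 2)).mono'
    (hf.mul (hf.log.div_const _)).aestronglyMeasurable (.of_forall fun y => ?_)
  set t := ‖y‖ ^ 2 with ht
  have ht0 : 0 ≤ t := by positivity
  have hlogf : |Real.log (f y)| ≤ M + b * t := by
    have h1 : Real.log a + -b * t ≤ Real.log (f y) := by
      rw [← Real.log_exp (-b * t), ← Real.log_mul ha.ne' (Real.exp_pos _).ne']
      exact Real.log_le_log (by positivity) (hlow y)
    have h2 : Real.log (f y) ≤ Real.log A + -c * t := by
      rw [← Real.log_exp (-c * t), ← Real.log_mul hA.ne' (Real.exp_pos _).ne']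
      exact Real.log_le_log (hpos y) (hup y)
    have hct : 0 ≤ c * t := by positivity
    have hbt : 0 ≤ b * t := by positivity
    rw [abs_le]
    constructor
    · linarith [neg_abs_le (Real.log a), abs_nonneg (Real.log A)]
    · linarith [le_abs_self (Real.log A), abs_nonneg (Real.log a)]
  have hexp : c / 2 * t ≤ Real.exp (c / 2 * t) := by linarith [Real.add_one_le_exp (c / 2 * t)]
  have hone : 1 ≤ Real.exp (c / 2 * t) := Real.one_le_exp (by positivity)
  have hlin : M + b * t ≤ (M + b * (2 / c)) * Real.exp (c / 2 * t) := by
    have : b * t ≤ b * (2 / c) * Real.exp (c / 2 * t) := by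
      calc b * t = b * (2 / c) * (c / 2 * t) := by field_simp
        _ ≤ _ := by gcongr
    nlinarith
  rw [Real.norm_eq_abs, abs_mul, abs_of_pos (hpos y), Real.logb, abs_div, abs_of_pos hlog2]
  have hsplit : Real.exp (-c * t) * Real.exp (c / 2 * t) = Real.exp (-(c / 2) * t) := by
    rw [← Real.exp_add]; ring_nf
  calc f y * (|Real.log (f y)| / Real.log 2)
      ≤ (A * Real.exp (-c * t)) *
          ((M + b * (2 / c)) * Real.exp (c / 2 * t) / Real.log 2) := by
        have := hup y
        have h3 := hlogf.trans hlin
        gcongr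
    _ = A * (M + b * (2 / c)) / Real.log 2 * (Real.exp (-c * t) * Real.exp (c / 2 * t)) := by ring
    _ = _ := by rw [hsplit]

/-! ### Smoothing a law by Gaussian noise -/

/-- The density of the sum of a random vector of law `μ` and independent Gaussian noise. -/
noncomputable def noisyDensity (σ : ℝ) (μ : Measure (EuclideanSpace ℝ (Fin N)))
    (y : EuclideanSpace ℝ (Fin N)) : ℝ :=
  ∫ x, gaussDensity σ (y - x) ∂μ

lemma noisyDensity_nonneg (hσ : 0 < σ) (μ : Measure (EuclideanSpace ℝ (Fin N)))
    (y : EuclideanSpace ℝ (Fin N)) : 0 ≤ noisyDensity σ μ y :=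
  integral_nonneg fun _ => (gaussDensity_pos hσ _).le

section Noisy

variable (μ : Measure (EuclideanSpace ℝ (Fin N))) [IsProbabilityMeasure μ]

lemma measurable_noisyDensity : Measurable (noisyDensity σ μ) := by
  have : StronglyMeasurable (fun p : EuclideanSpace ℝ (Fin N) × EuclideanSpace ℝ (Fin N) =>
      gaussDensity σ (p.1 - p.2)) :=
    (continuous_gaussDensity.comp (continuous_fst.sub continuous_snd)).stronglyMeasurable
  exact this.integral_prod_right.measurable

lemma gaussDensity_le (hσ : 0 < σ) (y : EuclideanSpace ℝ (Fin N)) :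
    gaussDensity σ y ≤ ((√(2 * Real.pi) * σ) ^ N)⁻¹ := by
  have hpi := Real.pi_pos
  rw [gaussDensity]
  refine mul_le_of_le_one_right (by positivity) (Real.exp_le_one_iff.2 ?_)
  rw [neg_div]
  exact neg_nonpos.2 (by positivity)

lemma integrable_gaussDensity_sub (hσ : 0 < σ) (y : EuclideanSpace ℝ (Fin N)) :
    Integrable (fun x => gaussDensity σ (y - x)) μ := by
  refine (integrable_const (((√(2 * Real.pi) * σ) ^ N)⁻¹)).mono'
    (continuous_gaussDensity.comp (continuous_const.sub continuous_id)).aestronglyMeasurable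
    (.of_forall fun x => ?_)
  rw [Real.norm_of_nonneg (gaussDensity_pos hσ _).le]
  exact gaussDensity_le hσ _

/-- Tonelli's theorem together with translation invariance of Lebesgue measure. -/
lemma conv_multivariateGaussian (hσ : 0 < σ) :
    μ ∗ multivariateGaussian 0 (σ ^ 2 • (1 : Matrix (Fin N) (Fin N) ℝ)) =
      volume.withDensity (fun y => ENNReal.ofReal (noisyDensity σ μ y)) := by
  refine Measure.ext_of_lintegral _ fun f hf => ?_
  have hg : Measurable (fun y : EuclideanSpace ℝ (Fin N) => ENNReal.ofReal (gaussDensity σ y)) :=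
    continuous_gaussDensity.measurable.ennreal_ofReal
  rw [Measure.lintegral_conv hf, lintegral_withDensity_eq_lintegral_mul _
    (measurable_noisyDensity μ).ennreal_ofReal hf, multivariateGaussian_eq_withDensity hσ]
  calc ∫⁻ x, ∫⁻ y, f (x + y) ∂(volume.withDensity fun y => ENNReal.ofReal (gaussDensity σ y)) ∂μ
      = ∫⁻ x, ∫⁻ y, ENNReal.ofReal (gaussDensity σ (y - x)) * f y ∂volume ∂μ := by
        refine lintegral_congr fun x => ?_
        rw [lintegral_withDensity_eq_lintegral_mul _ hg (by fun_prop),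
          ← lintegral_add_left_eq_self
            (fun y => ENNReal.ofReal (gaussDensity σ (y - x)) * f y) x]
        simp
    _ = ∫⁻ y, ∫⁻ x, ENNReal.ofReal (gaussDensity σ (y - x)) * f y ∂μ ∂volume := by
        refine lintegral_lintegral_swap ?_
        have h1 : Measurable
            (fun p : EuclideanSpace ℝ (Fin N) × EuclideanSpace ℝ (Fin N) =>
              ENNReal.ofReal (gaussDensity σ (p.2 - p.1))) := hg.comp (by fun_prop)
        exact (h1.mul (hf.comp measurable_snd)).aemeasurable
    _ = _ := by
        refine lintegral_congr fun y => ?_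
        have h1 : Measurable (fun x => ENNReal.ofReal (gaussDensity σ (y - x))) :=
          hg.comp (by fun_prop)
        rw [lintegral_mul_const _ h1, Pi.mul_apply, noisyDensity,
          ofReal_integral_eq_lintegral_ofReal (integrable_gaussDensity_sub μ hσ y)
            (.of_forall fun x => (gaussDensity_pos hσ _).le)]

/-- From `‖y - x‖ ^ 2 ≤ 2 * (‖y‖ ^ 2 + R ^ 2)`. The bound also supplies strict positivity of the
density. -/
lemma le_noisyDensity (hσ : 0 < σ) {R : ℝ} (hR : ∀ᵐ x ∂μ, ‖x‖ ≤ R)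
    (y : EuclideanSpace ℝ (Fin N)) :
    (((√(2 * Real.pi) * σ) ^ N)⁻¹ * Real.exp (-(R ^ 2 / σ ^ 2))) *
      Real.exp (-(σ ^ 2)⁻¹ * ‖y‖ ^ 2) ≤ noisyDensity σ μ y := by
  have hpi := Real.pi_pos
  have h := integral_mono_ae (μ := μ) (integrable_const (((√(2 * Real.pi) * σ) ^ N)⁻¹ *
    Real.exp (-(R ^ 2 / σ ^ 2)) * Real.exp (-(σ ^ 2)⁻¹ * ‖y‖ ^ 2)))
    (integrable_gaussDensity_sub μ hσ y) ?_
  · simpa [noisyDensity] using h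
  filter_upwards [hR] with x hx
  rw [gaussDensity, mul_assoc, ← Real.exp_add]
  gcongr
  have h1 : ‖y - x‖ ^ 2 ≤ 2 * (‖y‖ ^ 2 + R ^ 2) := by
    have : ‖y - x‖ ≤ ‖y‖ + ‖x‖ := norm_sub_le _ _
    nlinarith [norm_nonneg (y - x), norm_nonneg x, norm_nonneg y, sq_nonneg (‖y‖ - ‖x‖)]
  have h2 : ‖y - x‖ ^ 2 / (2 * σ ^ 2) ≤ 2 * (‖y‖ ^ 2 + R ^ 2) / (2 * σ ^ 2) := by gcongr
  have h3 : 2 * (‖y‖ ^ 2 + R ^ 2) / (2 * σ ^ 2) = R ^ 2 / σ ^ 2 + (σ ^ 2)⁻¹ * ‖y‖ ^ 2 := by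
    field_simp; ring
  rw [neg_div]
  linarith

/-- From `‖y - x‖ ^ 2 ≥ ‖y‖ ^ 2 / 2 - R ^ 2`; the price is a halved decay rate. -/
lemma noisyDensity_le (hσ : 0 < σ) {R : ℝ} (hR : ∀ᵐ x ∂μ, ‖x‖ ≤ R)
    (y : EuclideanSpace ℝ (Fin N)) :
    noisyDensity σ μ y ≤ (((√(2 * Real.pi) * σ) ^ N)⁻¹ * Real.exp (R ^ 2 / (2 * σ ^ 2))) *
      Real.exp (-(4 * σ ^ 2)⁻¹ * ‖y‖ ^ 2) := by
  have hpi := Real.pi_pos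
  have h := integral_mono_ae (μ := μ) (integrable_gaussDensity_sub μ hσ y)
    (integrable_const (((√(2 * Real.pi) * σ) ^ N)⁻¹ *
    Real.exp (R ^ 2 / (2 * σ ^ 2)) * Real.exp (-(4 * σ ^ 2)⁻¹ * ‖y‖ ^ 2))) ?_
  · simpa [noisyDensity] using h
  filter_upwards [hR] with x hx
  rw [gaussDensity, mul_assoc, ← Real.exp_add]
  gcongr
  have h1 : ‖y‖ ^ 2 / 2 - R ^ 2 ≤ ‖y - x‖ ^ 2 := by
    have : ‖y‖ ≤ ‖y - x‖ + ‖x‖ := by simpa using norm_add_le (y - x) x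
    nlinarith [norm_nonneg (y - x), norm_nonneg x, norm_nonneg y, sq_nonneg (‖y - x‖ - ‖x‖)]
  have h2 : (‖y‖ ^ 2 / 2 - R ^ 2) / (2 * σ ^ 2) ≤ ‖y - x‖ ^ 2 / (2 * σ ^ 2) := by gcongr
  have h3 : (‖y‖ ^ 2 / 2 - R ^ 2) / (2 * σ ^ 2) =
      -(R ^ 2 / (2 * σ ^ 2)) + (4 * σ ^ 2)⁻¹ * ‖y‖ ^ 2 := by
    field_simp; ring
  rw [neg_div]
  linarith

lemma integrable_noisyDensity_mul_logb (hσ : 0 < σ) {R : ℝ} (hR : ∀ᵐ x ∂μ, ‖x‖ ≤ R) :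
    Integrable (fun y => noisyDensity σ μ y * Real.logb 2 (noisyDensity σ μ y)) := by
  have hpi := Real.pi_pos
  exact integrable_mul_logb_of_gaussian_bounds (measurable_noisyDensity μ) (by positivity)
    (by positivity) (by positivity) (le_noisyDensity μ hσ hR) (noisyDensity_le μ hσ hR)

end Noisy

/-! ### Conditional law of the output and its entropy -/

/-- The differential entropy of a translate of the Gaussian noise. -/
lemma diffEntropy_dirac_conv (hσ : 0 < σ) (x : EuclideanSpace ℝ (Fin N)) :
    diffEntropy (Measure.dirac x ∗
        multivariateGaussian 0 (σ ^ 2 • (1 : Matrix (Fin N) (Fin N) ℝ))) =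
      N * Real.logb 2 (√(2 * Real.pi) * σ) + N / 2 / Real.log 2 := by
  have hpi := Real.pi_pos
  rw [conv_multivariateGaussian _ hσ, diffEntropy_withDensity (measurable_noisyDensity _)
    (noisyDensity_nonneg hσ _)]
  have h (y : EuclideanSpace ℝ (Fin N)) :
      noisyDensity σ (Measure.dirac x) y = gaussDensity σ (y - x) := by simp [noisyDensity]
  simp_rw [h]
  rw [integral_sub_right_eq_self
    (fun y : EuclideanSpace ℝ (Fin N) => gaussDensity σ y * Real.logb 2 (gaussDensity σ y)) x]
  -- The logarithm of the density is affine in `‖y‖ ^ 2`, so only the total mass and the second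
  -- moment enter.
  have hlog (y : EuclideanSpace ℝ (Fin N)) : gaussDensity σ y * Real.logb 2 (gaussDensity σ y) =
      -(N * Real.logb 2 (√(2 * Real.pi) * σ)) * gaussDensity σ y +
        -(2 * σ ^ 2 * Real.log 2)⁻¹ * (gaussDensity σ y * ‖y‖ ^ 2) := by
    have : Real.log (gaussDensity σ y) =
        -(N * Real.log (√(2 * Real.pi) * σ)) + -‖y‖ ^ 2 / (2 * σ ^ 2) := by
      rw [gaussDensity, Real.log_mul (by positivity) (Real.exp_pos _).ne', Real.log_inv,
        Real.log_pow, Real.log_exp]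
    rw [Real.logb, Real.logb, this]
    have := Real.log_pos one_lt_two
    field_simp
  simp_rw [hlog]
  have hsq : Integrable (fun y : EuclideanSpace ℝ (Fin N) => gaussDensity σ y * ‖y‖ ^ 2) := by
    -- A nonzero Bochner integral forces integrability. In dimension zero the second moment
    -- vanishes, so that case is separate.
    by_cases hN : N = 0
    · subst hN
      have : (fun y : EuclideanSpace ℝ (Fin 0) => gaussDensity σ y * ‖y‖ ^ 2) = 0 := by
        funext y
        simp [Subsingleton.elim y 0]
      rw [this]
      exact integrable_zero _ _ _
    · refine .of_integral_ne_zero ?_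
      rw [integral_gaussDensity_mul_sq_norm hσ]
      positivity
  rw [integral_add ((integrable_gaussDensity hσ).const_mul _) (hsq.const_mul _),
    integral_const_mul, integral_const_mul, integral_gaussDensity hσ,
    integral_gaussDensity_mul_sq_norm hσ]
  have := Real.log_pos one_lt_two
  field_simp
  ring

lemma hasDiffEntropy_dirac_conv (hσ : 0 < σ) (x : EuclideanSpace ℝ (Fin N)) :
    HasDiffEntropy (Measure.dirac x ∗
        multivariateGaussian 0 (σ ^ 2 • (1 : Matrix (Fin N) (Fin N) ℝ))) := by
  rw [conv_multivariateGaussian _ hσ]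
  refine hasDiffEntropy_withDensity (measurable_noisyDensity _) (noisyDensity_nonneg hσ _)
    (integrable_noisyDensity_mul_logb _ hσ (R := ‖x‖) ?_)
  rw [ae_dirac_eq]
  exact le_refl ‖x‖

/-- The conditional law of `X + Z` given `X = x`, for independent `X` and `Z`, is the translate
by `x` of the law of `Z`. -/
lemma condDistrib_add_of_indepFun {Ω : Type*} [MeasurableSpace Ω] {P : Measure Ω}
    [IsProbabilityMeasure P] {X Z : Ω → EuclideanSpace ℝ (Fin N)} (hX : AEMeasurable X P)
    (hZ : AEMeasurable Z P) (h : IndepFun X Z P) :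
    ∀ᵐ x ∂(P.map X), condDistrib (X + Z) X P x = Measure.dirac x ∗ P.map Z := by
  have := Measure.isProbabilityMeasure_map (μ := P) hZ
  have := Measure.isProbabilityMeasure_map (μ := P) hX
  have hadd : Measurable (fun p : EuclideanSpace ℝ (Fin N) × EuclideanSpace ℝ (Fin N) =>
    p.1 + p.2) := by fun_prop
  let κ : Kernel (EuclideanSpace ℝ (Fin N)) (EuclideanSpace ℝ (Fin N)) :=
    (Kernel.id ×ₖ Kernel.const _ (P.map Z)).map (fun p => p.1 + p.2)
  have hκ (x) : κ x = Measure.dirac x ∗ P.map Z := by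
    rw [Kernel.map_apply _ hadd, Kernel.prod_apply, Kernel.id_apply, Kernel.const_apply]
    rfl
  have hκfin : IsMarkovKernel κ := Kernel.IsMarkovKernel.map _ hadd
  -- Conditional laws are unique almost everywhere, so it is enough that `κ` disintegrates the joint
  -- law. By independence that law is the image of a product under the shear `(x, z) ↦ (x, x + z)`.
  suffices hc : P.map (fun ω => (X ω, (X + Z) ω)) = P.map X ⊗ₘ κ by
    filter_upwards [condDistrib_ae_eq_of_measure_eq_compProd X (hX.add hZ) hc] with x hx
    rw [hx, hκ]
  refine Measure.ext_of_lintegral _ fun f hf => ?_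
  have hprod := (indepFun_iff_map_prod_eq_prod_map_map hX hZ).1 h
  have hmap : P.map (fun ω => (X ω, (X + Z) ω)) =
      ((P.map X).prod (P.map Z)).map (fun p => (p.1, p.1 + p.2)) := by
    rw [← hprod, AEMeasurable.map_map_of_aemeasurable (by fun_prop) (hX.prodMk hZ)]
    rfl
  rw [hmap, lintegral_map hf (by fun_prop), lintegral_prod _ (by fun_prop),
    Measure.lintegral_compProd hf]
  refine lintegral_congr fun x => ?_
  rw [hκ, Measure.lintegral_conv (by fun_prop), lintegral_dirac' _ ?_]
  exact Measurable.lintegral_prod_right' (f := fun p => f (x, p.1 + p.2)) (by fun_prop)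

/-! ### Moments of a coordinate on the unit sphere, by comparison with Gaussian moments -/

lemma integral_pow_mul_exp_neg_sq_div_two_Ioi (n : ℕ) :
    ∫ r in Ioi (0 : ℝ), r ^ n * Real.exp (-r ^ 2 / 2) =
      (2 : ℝ) ^ (((n : ℝ) + 1) / 2) / 2 * Real.Gamma (((n : ℝ) + 1) / 2) := by
  have h := integral_rpow_mul_exp_neg_mul_rpow (p := 2) (q := n) (b := 1 / 2) two_pos
    (by linarith [(Nat.cast_nonneg n : (0 : ℝ) ≤ n)]) (by norm_num)
  rw [neg_div, Real.rpow_neg (by norm_num), one_div, Real.inv_rpow (by norm_num), inv_inv] at h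
  rw [div_eq_mul_inv (_ ^ _), ← h]
  refine setIntegral_congr_fun measurableSet_Ioi fun r _ => ?_
  simp only [Real.rpow_natCast]
  congr 2
  rw [show (2 : ℝ) = ((2 : ℕ) : ℝ) by norm_num, Real.rpow_natCast]
  push_cast
  ring

lemma integral_pow_gaussianReal (n : ℕ) :
    ∫ t, t ^ n ∂(gaussianReal 0 1) = (√(2 * Real.pi))⁻¹ * ∫ t, t ^ n * Real.exp (-t ^ 2 / 2) := by
  rw [integral_gaussianReal_eq_integral_smul one_ne_zero, ← integral_const_mul]
  congr 1 with t
  simp [gaussianPDFReal]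
  ring

lemma integral_even_pow_gaussianReal (m : ℕ) :
    ∫ t, t ^ (2 * m) ∂(gaussianReal 0 1) =
      2 ^ m * Real.Gamma ((m : ℝ) + 1 / 2) / √Real.pi := by
  rw [integral_pow_gaussianReal]
  have h := integral_comp_abs (f := fun t : ℝ => t ^ (2 * m) * Real.exp (-t ^ 2 / 2))
  have he (t : ℝ) : |t| ^ (2 * m) * Real.exp (-|t| ^ 2 / 2) =
      t ^ (2 * m) * Real.exp (-t ^ 2 / 2) := by
    rw [pow_mul, sq_abs, ← pow_mul]
  simp_rw [he] at h
  rw [h, integral_pow_mul_exp_neg_sq_div_two_Ioi]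
  have h1 : (((2 * m : ℕ) : ℝ) + 1) / 2 = (m : ℝ) + 1 / 2 := by push_cast; ring
  have hpi := Real.pi_pos
  rw [h1, Real.rpow_add two_pos, Real.rpow_natCast, ← Real.sqrt_eq_rpow,
    Real.sqrt_mul two_pos.le]
  field_simp

lemma integral_odd_pow_gaussianReal (m : ℕ) :
    ∫ t, t ^ (2 * m + 1) ∂(gaussianReal 0 1) = 0 := by
  rw [integral_pow_gaussianReal]
  have h := integral_neg_eq_self (fun t : ℝ => t ^ (2 * m + 1) * Real.exp (-t ^ 2 / 2)) volume
  have he (t : ℝ) : (-t) ^ (2 * m + 1) * Real.exp (-(-t) ^ 2 / 2) =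
      -(t ^ (2 * m + 1) * Real.exp (-t ^ 2 / 2)) := by
    rw [Odd.neg_pow ⟨m, rfl⟩, neg_sq]; ring
  simp_rw [he] at h
  rw [integral_neg] at h
  rw [show ∫ t : ℝ, t ^ (2 * m + 1) * Real.exp (-t ^ 2 / 2) = 0 by linarith, mul_zero]

/-- Polar coordinates for the product of a power of a linear form and a radial function. -/
lemma integral_inner_pow_mul_norm (hN : 1 ≤ N) (e : EuclideanSpace ℝ (Fin N)) (n : ℕ)
    (h : ℝ → ℝ) :
    ∫ x : EuclideanSpace ℝ (Fin N), inner ℝ e x ^ n * h ‖x‖ =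
      (∫ u, inner ℝ e (u : EuclideanSpace ℝ (Fin N)) ^ n
        ∂(volume : Measure (EuclideanSpace ℝ (Fin N))).toSphere) *
      ∫ r in Ioi (0 : ℝ), r ^ (N - 1 + n) * h r := by
  have : Nonempty (Fin N) := ⟨⟨0, hN⟩⟩
  set μ : Measure (EuclideanSpace ℝ (Fin N)) := volume
  calc ∫ x, inner ℝ e x ^ n * h ‖x‖ ∂μ
      = ∫ x : ({(0)}ᶜ : Set (EuclideanSpace ℝ (Fin N))), inner ℝ e x.1 ^ n * h ‖x.1‖
          ∂(μ.comap (↑)) := by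
        rw [integral_subtype_comap (measurableSet_singleton _).compl
          fun x : EuclideanSpace ℝ (Fin N) ↦ inner ℝ e x ^ n * h ‖x‖, restrict_compl_singleton]
    _ = ∫ q, inner ℝ e (q.1 : EuclideanSpace ℝ (Fin N)) ^ n * ((q.2 : ℝ) ^ n * h q.2)
          ∂μ.toSphere.prod (.volumeIoiPow (N - 1)) := by
        have hm := μ.measurePreserving_homeomorphUnitSphereProd
        rw [finrank_euclideanSpace, Fintype.card_fin] at hm
        rw [← hm.integral_comp (Homeomorph.measurableEmbedding _)]
        congr 1 with x
        have hx : ‖x.1‖ ≠ 0 := norm_ne_zero_iff.2 x.2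
        simp only [homeomorphUnitSphereProd_apply_fst_coe, homeomorphUnitSphereProd_apply_snd_coe,
          real_inner_smul_right]
        rw [mul_pow, inv_pow]
        field_simp
    _ = (∫ u, inner ℝ e (u : EuclideanSpace ℝ (Fin N)) ^ n ∂μ.toSphere) *
          ∫ r : Ioi (0 : ℝ), (r : ℝ) ^ n * h r ∂.volumeIoiPow (N - 1) :=
        -- No integrability of `h` is needed: the product formula holds also with the default value
        -- zero of divergent integrals.
        integral_prod_mul (fun u : Metric.sphere (0 : EuclideanSpace ℝ (Fin N)) 1 =>
          inner ℝ e (u : EuclideanSpace ℝ (Fin N)) ^ n) (fun r : Ioi (0 : ℝ) => (r : ℝ) ^ n * h r)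
    _ = _ := by
        congr 1
        simp only [Measure.volumeIoiPow, ENNReal.ofReal]
        rw [integral_withDensity_eq_integral_smul
            (measurable_subtype_coe.pow_const _).real_toNNReal,
          integral_subtype_comap measurableSet_Ioi
            fun a ↦ Real.toNNReal (a ^ (N - 1)) • (a ^ n * h a)]
        refine setIntegral_congr_fun measurableSet_Ioi fun x hx ↦ ?_
        simp only [NNReal.smul_def, Real.coe_toNNReal _ (pow_nonneg (mem_Ioi.1 hx).le _),
          smul_eq_mul]
        ring

/-- The uniform probability measure on the unit sphere. -/
noncomputable def unitSphereUniform (N : ℕ) :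
    Measure (Metric.sphere (0 : EuclideanSpace ℝ (Fin N)) 1) :=
  ((volume : Measure (EuclideanSpace ℝ (Fin N))).toSphere univ)⁻¹ •
    (volume : Measure (EuclideanSpace ℝ (Fin N))).toSphere

lemma isProbabilityMeasure_unitSphereUniform (hN : 1 ≤ N) :
    IsProbabilityMeasure (unitSphereUniform N) := by
  have : Nonempty (Fin N) := ⟨⟨0, hN⟩⟩
  have : NeZero (volume : Measure (EuclideanSpace ℝ (Fin N))).toSphere :=
    ⟨Measure.toSphere_ne_zero _⟩
  exact ⟨by
    rw [unitSphereUniform, Measure.smul_apply, smul_eq_mul]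
    exact ENNReal.inv_mul_cancel (Measure.measure_univ_ne_zero.2 NeZero.out)
      (measure_ne_top _ _)⟩

/-- A coordinate of a standard Gaussian vector is a standard real Gaussian, while polar coordinates
factor its moment into a spherical and a radial integral. The Gamma factor is the radial one. -/
lemma integral_toSphere_inner_pow (hN : 1 ≤ N) (e : EuclideanSpace ℝ (Fin N)) (he : ‖e‖ = 1)
    (n : ℕ) :
    ((√(2 * Real.pi)) ^ N)⁻¹ * ((∫ u, inner ℝ e (u : EuclideanSpace ℝ (Fin N)) ^ n
        ∂(volume : Measure (EuclideanSpace ℝ (Fin N))).toSphere) *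
      ((2 : ℝ) ^ (((N : ℝ) + n) / 2) / 2 * Real.Gamma (((N : ℝ) + n) / 2))) =
      ∫ t, t ^ n ∂(gaussianReal 0 1) := by
  have h := integral_multivariateGaussian (N := N) one_pos (fun x => inner ℝ e x ^ n)
  rw [one_pow, one_smul, multivariateGaussian_zero_one] at h
  rw [← map_inner_stdGaussian e he, integral_map (by fun_prop) (by fun_prop), h]
  have h2 := integral_inner_pow_mul_norm hN e n
    (fun r => ((√(2 * Real.pi)) ^ N)⁻¹ * Real.exp (-r ^ 2 / 2))
  have h3 (x : EuclideanSpace ℝ (Fin N)) : gaussDensity 1 x * inner ℝ e x ^ n =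
      inner ℝ e x ^ n * (((√(2 * Real.pi)) ^ N)⁻¹ * Real.exp (-‖x‖ ^ 2 / 2)) := by
    rw [gaussDensity, mul_one, one_pow, mul_one]; ring
  simp_rw [h3]
  rw [h2]
  simp_rw [mul_left_comm (_ ^ (N - 1 + n))]
  rw [integral_const_mul, integral_pow_mul_exp_neg_sq_div_two_Ioi]
  have h4 : ((N - 1 + n : ℕ) : ℝ) + 1 = N + n := by
    rw [Nat.cast_add, Nat.cast_sub hN]; push_cast; ring
  rw [h4]
  ring

/-- The moments of a coordinate of a uniform point of the unit sphere. -/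
lemma integral_unitSphereUniform_inner_pow (hN : 1 ≤ N) (e : EuclideanSpace ℝ (Fin N))
    (he : ‖e‖ = 1) (n : ℕ) :
    (∫ u, inner ℝ e (u : EuclideanSpace ℝ (Fin N)) ^ n ∂unitSphereUniform N) *
      ((2 : ℝ) ^ ((n : ℝ) / 2) * Real.Gamma (((N : ℝ) + n) / 2)) =
      Real.Gamma ((N : ℝ) / 2) * ∫ t, t ^ n ∂(gaussianReal 0 1) := by
  -- The case `n = 0` expresses the total surface measure; dividing by it removes the normalizing
  -- constants, and it shows that this measure is nonzero.
  have h0 := integral_toSphere_inner_pow hN e he 0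
  have hn := integral_toSphere_inner_pow hN e he n
  simp only [pow_zero, integral_const, probReal_univ, smul_eq_mul, mul_one, Nat.cast_zero,
    add_zero] at h0
  rw [unitSphereUniform, integral_smul_measure, ENNReal.toReal_inv, smul_eq_mul, ← hn]
  rw [← measureReal_def]
  set S := (volume : Measure (EuclideanSpace ℝ (Fin N))).toSphere.real univ
  set A := ∫ u, inner ℝ e (u : EuclideanSpace ℝ (Fin N)) ^ n
        ∂(volume : Measure (EuclideanSpace ℝ (Fin N))).toSphere
  have hS : S ≠ 0 := by
    rintro hS
    simp [hS] at h0
  have hsplit : (2 : ℝ) ^ (((N : ℝ) + n) / 2) = 2 ^ ((N : ℝ) / 2) * 2 ^ ((n : ℝ) / 2) := by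
    rw [← Real.rpow_add two_pos]; ring_nf
  rw [hsplit]
  calc _ = S⁻¹ * A * (2 ^ ((n : ℝ) / 2) * Real.Gamma (((N : ℝ) + n) / 2)) * 1 := by ring
    _ = _ := by
      rw [← h0]
      field_simp

lemma integral_unitSphereUniform_inner_even_pow (hN : 1 ≤ N) (e : EuclideanSpace ℝ (Fin N))
    (he : ‖e‖ = 1) (m : ℕ) :
    (∫ u, inner ℝ e (u : EuclideanSpace ℝ (Fin N)) ^ (2 * m) ∂unitSphereUniform N) =
      (2 * m).factorial / (4 ^ m * m.factorial) * Real.Gamma ((N : ℝ) / 2) /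
        Real.Gamma ((m : ℝ) + (N : ℝ) / 2) := by
  have h := integral_unitSphereUniform_inner_pow hN e he (2 * m)
  have hN' : (0 : ℝ) < N := by exact_mod_cast hN
  have hG : 0 < Real.Gamma ((m : ℝ) + (N : ℝ) / 2) := Real.Gamma_pos_of_pos (by positivity)
  -- Legendre's duplication formula at `m + 1 / 2` converts the half-integer Gamma value into
  -- factorials.
  have hdup := Real.Gamma_mul_Gamma_add_half ((m : ℝ) + 1 / 2)
  rw [show (m : ℝ) + 1 / 2 + 1 / 2 = m + 1 by ring,
    show 2 * ((m : ℝ) + 1 / 2) = ((2 * m : ℕ) : ℝ) + 1 by push_cast; ring,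
    Real.Gamma_nat_eq_factorial, Real.Gamma_nat_eq_factorial,
    show 1 - (((2 * m : ℕ) : ℝ) + 1) = -((2 * m : ℕ) : ℝ) by ring,
    Real.rpow_neg two_pos.le, Real.rpow_natCast, pow_mul] at hdup
  rw [integral_even_pow_gaussianReal, show ((2 * m : ℕ) : ℝ) / 2 = (m : ℝ) by push_cast; ring,
    Real.rpow_natCast,
    show ((N : ℝ) + (2 * m : ℕ)) / 2 = (m : ℝ) + (N : ℝ) / 2 by push_cast; ring] at h
  have hpi : 0 < √Real.pi := Real.sqrt_pos.2 Real.pi_pos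
  have hf : (0 : ℝ) < m.factorial := by positivity
  have hGm : Real.Gamma ((m : ℝ) + 1 / 2) =
      (2 * m).factorial * (4 ^ m)⁻¹ * √Real.pi / m.factorial := by
    rw [eq_div_iff hf.ne', hdup]; norm_num
  rw [hGm] at h
  rw [eq_div_iff hG.ne']
  have h2 : (0 : ℝ) < 2 ^ m := by positivity
  apply mul_left_cancel₀ h2.ne'
  calc _ = _ := by ring
    _ = _ := h
    _ = _ := by field_simp

lemma integral_unitSphereUniform_inner_odd_pow (hN : 1 ≤ N) (e : EuclideanSpace ℝ (Fin N))
    (he : ‖e‖ = 1) (m : ℕ) :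
    (∫ u, inner ℝ e (u : EuclideanSpace ℝ (Fin N)) ^ (2 * m + 1) ∂unitSphereUniform N) = 0 := by
  have h := integral_unitSphereUniform_inner_pow hN e he (2 * m + 1)
  have hN' : (0 : ℝ) < N := by exact_mod_cast hN
  rw [integral_odd_pow_gaussianReal, mul_zero] at h
  have hG : 0 < Real.Gamma (((N : ℝ) + (2 * m + 1 : ℕ)) / 2) :=
    Real.Gamma_pos_of_pos (by positivity)
  exact (mul_eq_zero.1 h).resolve_right (by positivity)

/-- The moment generating function of a coordinate of a uniform point of the unit sphere. -/
lemma hasSum_integral_exp_inner (hN : 1 ≤ N) (e : EuclideanSpace ℝ (Fin N)) (he : ‖e‖ = 1)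
    (t : ℝ) :
    HasSum (fun m : ℕ => (t / 2) ^ (2 * m) / (m.factorial * Real.Gamma ((m : ℝ) + (N : ℝ) / 2)) *
        Real.Gamma ((N : ℝ) / 2))
      (∫ u, Real.exp (t * inner ℝ e (u : EuclideanSpace ℝ (Fin N))) ∂unitSphereUniform N) := by
  have := isProbabilityMeasure_unitSphereUniform hN
  have hin (u : Metric.sphere (0 : EuclideanSpace ℝ (Fin N)) 1) :
      |inner ℝ e (u : EuclideanSpace ℝ (Fin N))| ≤ 1 := by
    have h := abs_real_inner_le_norm e (u : EuclideanSpace ℝ (Fin N))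
    rwa [he, norm_eq_of_mem_sphere, one_mul] at h
  have hs : HasSum (fun n : ℕ => ∫ u, (t * inner ℝ e (u : EuclideanSpace ℝ (Fin N))) ^ n /
      n.factorial ∂unitSphereUniform N)
      (∫ u, Real.exp (t * inner ℝ e (u : EuclideanSpace ℝ (Fin N))) ∂unitSphereUniform N) := by
    -- Coordinates on the unit sphere are at most one in absolute value, so the exponential series
    -- for `|t|` dominates and can be integrated termwise.
    refine hasSum_integral_of_dominated_convergence (fun n _ => |t| ^ n / n.factorial)
      (fun n => by fun_prop) (fun n => .of_forall fun u => ?_)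
      (.of_forall fun _ => Real.summable_pow_div_factorial _) (integrable_const _)
      (.of_forall fun u => ?_)
    · rw [norm_div, norm_pow, norm_mul, Real.norm_eq_abs, Real.norm_eq_abs, Real.norm_natCast]
      gcongr
      exact mul_le_of_le_one_right (abs_nonneg t) (hin u)
    · rw [Real.exp_eq_exp_ℝ]
      exact NormedSpace.expSeries_div_hasSum_exp _
  have hterm (n : ℕ) : ∫ u, (t * inner ℝ e (u : EuclideanSpace ℝ (Fin N))) ^ n /
      n.factorial ∂unitSphereUniform N = t ^ n / n.factorial *
        ∫ u, inner ℝ e (u : EuclideanSpace ℝ (Fin N)) ^ n ∂unitSphereUniform N := by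
    rw [← integral_const_mul]
    congr 1 with u
    rw [mul_pow]; ring
  simp_rw [hterm] at hs
  -- Odd moments vanish, so the sum is reindexed over even exponents.
  have hinj : Function.Injective (fun m : ℕ => 2 * m) := fun a b h => by simpa using h
  rw [← hinj.hasSum_iff] at hs
  · convert hs using 1
    funext m
    rw [Function.comp_apply, integral_unitSphereUniform_inner_even_pow hN e he, div_pow,
      pow_mul (2 : ℝ)]
    have : (0 : ℝ) < (2 * m).factorial := by positivity
    norm_num
    field_simp
  · intro n hn
    rcases Nat.even_or_odd' n with ⟨m, rfl | rfl⟩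
    · exact absurd ⟨m, rfl⟩ hn
    · rw [integral_unitSphereUniform_inner_odd_pow hN e he, mul_zero]

/-! ### Multisphere laws and the noncentral chi density -/

lemma sphereUniform_eq_map (N : ℕ) (s : ℝ) :
    sphereUniform N s = (unitSphereUniform N).map
      (fun u : Metric.sphere (0 : EuclideanSpace ℝ (Fin N)) 1 =>
        s • (u : EuclideanSpace ℝ (Fin N))) := rfl

lemma isProbabilityMeasure_sphereUniform (hN : 1 ≤ N) (s : ℝ) :
    IsProbabilityMeasure (sphereUniform N s) := by
  have := isProbabilityMeasure_unitSphereUniform hN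
  rw [sphereUniform_eq_map]
  exact Measure.isProbabilityMeasure_map (by fun_prop)

lemma isProbabilityMeasure_multisphere (hN : 1 ≤ N) {K : ℕ} {p : Fin K → ℝ} (s : Fin K → ℝ)
    (hp : ∀ k, 0 ≤ p k) (hp_sum : ∑ k, p k = 1) : IsProbabilityMeasure (multisphere N p s) := by
  refine ⟨?_⟩
  have := fun k => isProbabilityMeasure_sphereUniform hN (s k)
  simp only [multisphere, Measure.coe_finsetSum, Finset.sum_apply, Measure.smul_apply,
    measure_univ, smul_eq_mul, mul_one]
  rw [← ENNReal.ofReal_sum_of_nonneg (fun k _ => hp k), hp_sum, ENNReal.ofReal_one]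

/-- Any common bound on the radii would do; their sum avoids taking a maximum. -/
lemma ae_norm_le_multisphere {K : ℕ} (p : Fin K → ℝ) {s : Fin K → ℝ} (hs : ∀ k, 0 ≤ s k) :
    ∀ᵐ x ∂(multisphere N p s), ‖x‖ ≤ ∑ k, s k := by
  rw [ae_iff, multisphere, Measure.coe_finsetSum, Finset.sum_apply, Finset.sum_eq_zero_iff]
  intro k _
  rw [← ae_iff]
  refine Measure.ae_smul_measure ?_ _
  rw [sphereUniform_eq_map, ae_map_iff (by fun_prop) (measurableSet_le (by fun_prop) (by fun_prop))]
  refine .of_forall fun u => ?_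
  rw [norm_smul, norm_eq_of_mem_sphere, mul_one, Real.norm_of_nonneg (hs k)]
  exact Finset.single_le_sum (f := s) (fun j _ => hs j) (Finset.mem_univ k)

/-- The noncentral chi density in terms of the moment generating function of a coordinate of a
uniform point of the unit sphere. -/
lemma chi_eq (hN : 1 ≤ N) (e : EuclideanSpace ℝ (Fin N)) (he : ‖e‖ = 1) {r t : ℝ} (hr : 0 < r)
    (ht : 0 ≤ t) :
    chi N r t = r ^ (N - 1) * (2 ^ (1 - (N : ℝ) / 2) / Real.Gamma ((N : ℝ) / 2)) *
      Real.exp (-(r ^ 2 + t ^ 2) / 2) *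
      ∫ u, Real.exp (r * t * inner ℝ e (u : EuclideanSpace ℝ (Fin N))) ∂unitSphereUniform N := by
  have := isProbabilityMeasure_unitSphereUniform hN
  have hN' : (0 : ℝ) < N := by exact_mod_cast hN
  have hG : 0 < Real.Gamma ((N : ℝ) / 2) := Real.Gamma_pos_of_pos (by positivity)
  have h2 : (2 : ℝ) ^ (1 - (N : ℝ) / 2) = ((2 : ℝ) ^ ((N : ℝ) / 2 - 1))⁻¹ := by
    rw [← Real.rpow_neg two_pos.le, neg_sub]
  have hrN : r ^ (N - 1) = r ^ ((N : ℝ) - 1) := by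
    rw [← Real.rpow_natCast, Nat.cast_sub hN, Nat.cast_one]
  rcases ht.eq_or_lt with rfl | ht
  · simp only [chi, if_true, mul_zero, zero_mul, Real.exp_zero, integral_const, probReal_univ,
      smul_eq_mul, mul_one]
    rw [hrN, h2]
    ring_nf
  · rw [chi, if_neg ht.ne', ← (hasSum_integral_exp_inner hN e he (r * t)).tsum_eq, besselI,
      tsum_mul_right]
    have hterm (m : ℕ) : (r * t / 2) ^ (2 * (m : ℝ) + ((N : ℝ) / 2 - 1)) /
        ((m.factorial : ℝ) * Real.Gamma ((m : ℝ) + ((N : ℝ) / 2 - 1) + 1)) =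
        (r * t / 2) ^ ((N : ℝ) / 2 - 1) * ((r * t / 2) ^ (2 * m) /
          (m.factorial * Real.Gamma ((m : ℝ) + (N : ℝ) / 2))) := by
      rw [Real.rpow_add (by positivity), show 2 * (m : ℝ) = ((2 * m : ℕ) : ℝ) by push_cast; ring,
        Real.rpow_natCast, show (m : ℝ) + ((N : ℝ) / 2 - 1) + 1 = m + (N : ℝ) / 2 by ring]
      ring
    simp_rw [hterm]
    -- The factor `(r * t / 2) ^ (N / 2 - 1)` taken out of the Bessel series cancels the power of
    -- `t` in `chi` and raises `r ^ (N / 2)` to `r ^ (N - 1)`.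
    rw [tsum_mul_left, hrN, h2, Real.div_rpow (by positivity) two_pos.le,
      Real.mul_rpow hr.le ht.le,
      show (N : ℝ) - 1 = (N : ℝ) / 2 + ((N : ℝ) / 2 - 1) by ring, Real.rpow_add hr]
    have : 0 < t ^ ((N : ℝ) / 2 - 1) := by positivity
    field_simp

/-- The product of `σ ^ N` and the area `2 π ^ (N / 2) / Γ(N / 2)` of the unit sphere of `ℝ^N`. -/
noncomputable def sphereArea (N : ℕ) (σ : ℝ) : ℝ :=
  σ ^ N * (2 * √Real.pi ^ N / Real.Gamma ((N : ℝ) / 2))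

lemma sphereArea_pos (hN : 1 ≤ N) (hσ : 0 < σ) : 0 < sphereArea N σ := by
  have hN' : (0 : ℝ) < N := by exact_mod_cast hN
  have hG : 0 < Real.Gamma ((N : ℝ) / 2) := Real.Gamma_pos_of_pos (by positivity)
  have := Real.pi_pos
  unfold sphereArea
  positivity

lemma nat_mul_volume_ball_mul_pow (hN : 1 ≤ N) (σ : ℝ) :
    N * (volume : Measure (EuclideanSpace ℝ (Fin N))).real (Metric.ball 0 1) * σ ^ N =
      sphereArea N σ := by
  have : Nonempty (Fin N) := ⟨⟨0, hN⟩⟩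
  have hN' : (0 : ℝ) < N := by exact_mod_cast hN
  have hG : 0 < Real.Gamma ((N : ℝ) / 2) := Real.Gamma_pos_of_pos (by positivity)
  have hpi := Real.pi_pos
  rw [measureReal_def, EuclideanSpace.volume_ball, Fintype.card_fin, ENNReal.ofReal_one, one_pow,
    one_mul, Real.Gamma_add_one (by positivity), ENNReal.toReal_ofReal (by positivity), sphereArea]
  field_simp

/-- Expanding `‖y - s • u‖ ^ 2` leaves one term depending on `u`, an inner product with the
direction `‖y‖⁻¹ • y`; this is why `y ≠ 0` is required. -/
lemma noisyDensity_sphereUniform (hN : 1 ≤ N) (hσ : 0 < σ) {s : ℝ} (hs : 0 ≤ s)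
    {y : EuclideanSpace ℝ (Fin N)} (hy : y ≠ 0) :
    noisyDensity σ (sphereUniform N s) y =
      (sphereArea N σ)⁻¹ * (chi N (‖y‖ / σ) (s / σ) / (‖y‖ / σ) ^ (N - 1)) := by
  have hN' : (0 : ℝ) < N := by exact_mod_cast hN
  have hG : 0 < Real.Gamma ((N : ℝ) / 2) := Real.Gamma_pos_of_pos (by positivity)
  have hpi := Real.pi_pos
  have hy' : 0 < ‖y‖ := norm_pos_iff.2 hy
  have he : ‖‖y‖⁻¹ • y‖ = 1 := by
    rw [norm_smul, norm_inv, norm_norm, inv_mul_cancel₀ hy'.ne']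
  have hcont : Continuous (fun x => gaussDensity σ (y - x)) :=
    continuous_gaussDensity.comp (continuous_const.sub continuous_id)
  rw [chi_eq hN (‖y‖⁻¹ • y) he (by positivity) (by positivity), noisyDensity, sphereUniform_eq_map,
    integral_map (by fun_prop) hcont.aestronglyMeasurable]
  have hint (u : Metric.sphere (0 : EuclideanSpace ℝ (Fin N)) 1) :
      gaussDensity σ (y - s • (u : EuclideanSpace ℝ (Fin N))) =
      ((√(2 * Real.pi) * σ) ^ N)⁻¹ * Real.exp (-((‖y‖ / σ) ^ 2 + (s / σ) ^ 2) / 2) *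
        Real.exp (‖y‖ / σ * (s / σ) *
          inner ℝ (‖y‖⁻¹ • y) (u : EuclideanSpace ℝ (Fin N))) := by
    rw [gaussDensity, mul_assoc, ← Real.exp_add, norm_sub_sq_real, norm_smul,
      norm_eq_of_mem_sphere, mul_one, Real.norm_of_nonneg hs, real_inner_smul_left,
      real_inner_smul_right]
    congr 2
    field_simp
    ring
  simp_rw [hint]
  rw [integral_const_mul]
  set M := ∫ u, Real.exp (‖y‖ / σ * (s / σ) *
    inner ℝ (‖y‖⁻¹ • y) (u : EuclideanSpace ℝ (Fin N))) ∂unitSphereUniform N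
  set D := Real.exp (-((‖y‖ / σ) ^ 2 + (s / σ) ^ 2) / 2)
  have h2 : (2 : ℝ) ^ (1 - (N : ℝ) / 2) = 2 / √2 ^ N := by
    rw [Real.rpow_sub two_pos, Real.rpow_one, Real.sqrt_eq_rpow, ← Real.rpow_mul_natCast two_pos.le]
    ring_nf
  rw [h2, sphereArea, Real.sqrt_mul two_pos.le, mul_pow, mul_pow]
  have : 0 < (‖y‖ / σ) ^ (N - 1) := by positivity
  field_simp

lemma noisyDensity_multisphere (hN : 1 ≤ N) (hσ : 0 < σ) {K : ℕ} {p s : Fin K → ℝ}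
    (hp : ∀ k, 0 ≤ p k) (hs : ∀ k, 0 ≤ s k) {y : EuclideanSpace ℝ (Fin N)} (hy : y ≠ 0) :
    noisyDensity σ (multisphere N p s) y =
      (sphereArea N σ)⁻¹ * (radialDensity N σ p s (‖y‖ / σ) / (‖y‖ / σ) ^ (N - 1)) := by
  have := fun k => isProbabilityMeasure_sphereUniform hN (s k)
  rw [noisyDensity, multisphere, integral_finsetSum_measure]
  · simp_rw [integral_smul_measure, ENNReal.toReal_ofReal (hp _), smul_eq_mul]
    change ∑ k, p k * noisyDensity σ (sphereUniform N (s k)) y = _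
    simp_rw [noisyDensity_sphereUniform hN hσ (hs _) hy, radialDensity, Finset.sum_div,
      Finset.mul_sum]
    refine Finset.sum_congr rfl fun k _ => ?_
    ring
  · intro k _
    exact (integrable_gaussDensity_sub _ hσ y).smul_measure ENNReal.ofReal_ne_top

lemma noisyDensity_multisphere_ae (hN : 1 ≤ N) (hσ : 0 < σ) {K : ℕ} {p s : Fin K → ℝ}
    (hp : ∀ k, 0 ≤ p k) (hs : ∀ k, 0 ≤ s k) :
    ∀ᵐ y : EuclideanSpace ℝ (Fin N), noisyDensity σ (multisphere N p s) y =
      (sphereArea N σ)⁻¹ * (radialDensity N σ p s (‖y‖ / σ) / (‖y‖ / σ) ^ (N - 1)) := by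
  have : Nonempty (Fin N) := ⟨⟨0, hN⟩⟩
  filter_upwards [Measure.ae_ne volume (0 : EuclideanSpace ℝ (Fin N))] with y hy
  exact noisyDensity_multisphere hN hσ hp hs hy

/-- Lets the mixture inherit positivity from the Gaussian lower bound on the output density. -/
lemma radialDensity_eq_noisyDensity (hN : 1 ≤ N) (hσ : 0 < σ) {K : ℕ} {p s : Fin K → ℝ}
    (hp : ∀ k, 0 ≤ p k) (hs : ∀ k, 0 ≤ s k) {e : EuclideanSpace ℝ (Fin N)} (he : ‖e‖ = 1)
    {r : ℝ} (hr : 0 < r) :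
    radialDensity N σ p s r =
      sphereArea N σ * r ^ (N - 1) * noisyDensity σ (multisphere N p s) ((σ * r) • e) := by
  have he0 : e ≠ 0 := norm_ne_zero_iff.1 (by rw [he]; exact one_ne_zero)
  rw [noisyDensity_multisphere hN hσ hp hs (smul_ne_zero (by positivity) he0), norm_smul, he,
    Real.norm_of_nonneg (by positivity), mul_one, mul_div_cancel_left₀ _ hσ.ne']
  have := sphereArea_pos hN hσ
  field_simp

lemma exists_norm_eq_one (hN : 1 ≤ N) : ∃ e : EuclideanSpace ℝ (Fin N), ‖e‖ = 1 :=
  ⟨EuclideanSpace.single ⟨0, hN⟩ 1, by simp⟩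

lemma radialDensity_pos (hN : 1 ≤ N) (hσ : 0 < σ) {K : ℕ} {p s : Fin K → ℝ}
    (hp : ∀ k, 0 ≤ p k) (hp_sum : ∑ k, p k = 1) (hs : ∀ k, 0 ≤ s k) {r : ℝ} (hr : 0 < r) :
    0 < radialDensity N σ p s r := by
  obtain ⟨e, he⟩ := exists_norm_eq_one hN
  have := isProbabilityMeasure_multisphere hN s hp hp_sum
  have hpi := Real.pi_pos
  have hS := sphereArea_pos hN hσ
  have h := le_noisyDensity (multisphere N p s) hσ (ae_norm_le_multisphere p hs) ((σ * r) • e)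
  have h' : 0 < noisyDensity σ (multisphere N p s) ((σ * r) • e) :=
    lt_of_lt_of_le (by positivity) h
  rw [radialDensity_eq_noisyDensity hN hσ hp hs he hr]
  positivity

/-! ### Polar coordinates for the output and the law of its radius -/

lemma noisyDensity_mul_comp_norm_ae (hN : 1 ≤ N) (hσ : 0 < σ) {K : ℕ} {p s : Fin K → ℝ}
    (hp : ∀ k, 0 ≤ p k) (hs : ∀ k, 0 ≤ s k) (h : ℝ → ℝ) :
    (fun y : EuclideanSpace ℝ (Fin N) => noisyDensity σ (multisphere N p s) y * h (‖y‖ / σ))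
      =ᵐ[volume] fun y => (fun ρ : ℝ => (sphereArea N σ)⁻¹ *
        (radialDensity N σ p s (σ⁻¹ * ρ) / (σ⁻¹ * ρ) ^ (N - 1)) * h (σ⁻¹ * ρ)) ‖y‖ := by
  filter_upwards [noisyDensity_multisphere_ae hN hσ hp hs] with y hy
  rw [hy, div_eq_inv_mul ‖y‖]

/-- The Jacobian `r ^ (N - 1)` cancels the denominator of the radial form, and `N` times the volume
of the unit ball times `σ ^ N` cancels `sphereArea N σ`. The test function `h` is arbitrary, so
constants, indicators and logarithms are all covered. -/
lemma integral_noisyDensity_mul_comp_norm (hN : 1 ≤ N) (hσ : 0 < σ) {K : ℕ} {p s : Fin K → ℝ}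
    (hp : ∀ k, 0 ≤ p k) (hs : ∀ k, 0 ≤ s k) (h : ℝ → ℝ) :
    ∫ y : EuclideanSpace ℝ (Fin N), noisyDensity σ (multisphere N p s) y * h (‖y‖ / σ) =
      ∫ r in Ioi (0 : ℝ), radialDensity N σ p s r * h r := by
  have : Nonempty (Fin N) := ⟨⟨0, hN⟩⟩
  have hS := sphereArea_pos hN hσ
  rw [integral_congr_ae (noisyDensity_mul_comp_norm_ae hN hσ hp hs h),
    integral_fun_norm_addHaar volume (fun ρ : ℝ =>
      (sphereArea N σ)⁻¹ * (radialDensity N σ p s (σ⁻¹ * ρ) / (σ⁻¹ * ρ) ^ (N - 1)) * h (σ⁻¹ * ρ)),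
    finrank_euclideanSpace, Fintype.card_fin]
  -- Prepares the substitution `ρ = σ * r`: the Jacobian yields `σ ^ (N - 1)`, and the last factor
  -- `σ` comes from the change of variable.
  have hcongr : ∫ ρ in Ioi (0 : ℝ), ρ ^ (N - 1) • ((sphereArea N σ)⁻¹ *
        (radialDensity N σ p s (σ⁻¹ * ρ) / (σ⁻¹ * ρ) ^ (N - 1)) * h (σ⁻¹ * ρ)) =
      ∫ ρ in Ioi (0 : ℝ), (fun r => (sphereArea N σ)⁻¹ * σ ^ (N - 1) *
        (radialDensity N σ p s r * h r)) (σ⁻¹ * ρ) := by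
    refine setIntegral_congr_fun measurableSet_Ioi fun ρ hρ => ?_
    have hρ' : 0 < ρ := hρ
    simp only [smul_eq_mul, mul_pow, inv_pow]
    field_simp
  rw [hcongr, integral_comp_mul_left_Ioi (fun r : ℝ => (sphereArea N σ)⁻¹ * σ ^ (N - 1) *
      (radialDensity N σ p s r * h r)) _ (inv_pos.2 hσ), mul_zero, integral_const_mul, inv_inv,
    nsmul_eq_mul, smul_eq_mul, smul_eq_mul]
  have hpow : σ ^ N = σ * σ ^ (N - 1) := by rw [← pow_succ', Nat.sub_add_cancel hN]
  calc _ = (N * (volume : Measure (EuclideanSpace ℝ (Fin N))).real (Metric.ball 0 1) *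
            (σ * σ ^ (N - 1))) * (sphereArea N σ)⁻¹ *
            ∫ r in Ioi (0 : ℝ), radialDensity N σ p s r * h r := by ring
    _ = _ := by
      rw [← hpow, nat_mul_volume_ball_mul_pow hN, mul_inv_cancel₀ hS.ne', one_mul]

lemma integrable_noisyDensity_mul_comp_norm_iff (hN : 1 ≤ N) (hσ : 0 < σ) {K : ℕ}
    {p s : Fin K → ℝ} (hp : ∀ k, 0 ≤ p k) (hs : ∀ k, 0 ≤ s k) (h : ℝ → ℝ) :
    Integrable (fun y : EuclideanSpace ℝ (Fin N) =>
      noisyDensity σ (multisphere N p s) y * h (‖y‖ / σ)) ↔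
      IntegrableOn (fun r => radialDensity N σ p s r * h r) (Ioi (0 : ℝ)) := by
  have : Nonempty (Fin N) := ⟨⟨0, hN⟩⟩
  have hS := sphereArea_pos hN hσ
  rw [integrable_congr (noisyDensity_mul_comp_norm_ae hN hσ hp hs h),
    integrable_fun_norm_addHaar volume (f := fun ρ : ℝ =>
      (sphereArea N σ)⁻¹ * (radialDensity N σ p s (σ⁻¹ * ρ) / (σ⁻¹ * ρ) ^ (N - 1)) * h (σ⁻¹ * ρ)),
    finrank_euclideanSpace, Fintype.card_fin]
  have hcongr : EqOn (fun ρ : ℝ => ρ ^ (N - 1) • ((sphereArea N σ)⁻¹ *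
        (radialDensity N σ p s (σ⁻¹ * ρ) / (σ⁻¹ * ρ) ^ (N - 1)) * h (σ⁻¹ * ρ)))
      (fun ρ : ℝ => (fun r => (sphereArea N σ)⁻¹ * σ ^ (N - 1) *
        (radialDensity N σ p s r * h r)) (σ⁻¹ * ρ)) (Ioi 0) := by
    intro ρ hρ
    have hρ' : 0 < ρ := hρ
    simp only [smul_eq_mul, mul_pow, inv_pow]
    field_simp
  rw [integrableOn_congr_fun hcongr measurableSet_Ioi,
    integrableOn_Ioi_comp_mul_left_iff (fun r : ℝ => (sphereArea N σ)⁻¹ * σ ^ (N - 1) *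
      (radialDensity N σ p s r * h r)) _ (inv_pos.2 hσ), mul_zero, IntegrableOn, IntegrableOn,
    integrable_const_mul_iff]
  exact (by positivity : (sphereArea N σ)⁻¹ * σ ^ (N - 1) ≠ 0).isUnit

lemma integrable_noisyDensity (hσ : 0 < σ) (μ : Measure (EuclideanSpace ℝ (Fin N)))
    [IsProbabilityMeasure μ] : Integrable (noisyDensity σ μ) := by
  refine ⟨(measurable_noisyDensity μ).aestronglyMeasurable, ?_⟩
  rw [hasFiniteIntegral_iff_ofReal (.of_forall (noisyDensity_nonneg hσ μ)), ← setLIntegral_univ,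
    ← withDensity_apply _ .univ, ← conv_multivariateGaussian μ hσ]
  exact measure_lt_top _ _

lemma integral_noisyDensity (hσ : 0 < σ) (μ : Measure (EuclideanSpace ℝ (Fin N)))
    [IsProbabilityMeasure μ] : ∫ y, noisyDensity σ μ y = 1 := by
  rw [integral_eq_lintegral_of_nonneg_ae (.of_forall (noisyDensity_nonneg hσ μ))
    (measurable_noisyDensity μ).aestronglyMeasurable, ← setLIntegral_univ,
    ← withDensity_apply _ .univ, ← conv_multivariateGaussian μ hσ]
  simp

/-- The law of the normalized norm of a multisphere vector plus Gaussian noise. -/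
lemma map_norm_div_conv_multisphere (hN : 1 ≤ N) (hσ : 0 < σ) {K : ℕ} {p s : Fin K → ℝ}
    (hp : ∀ k, 0 ≤ p k) (hp_sum : ∑ k, p k = 1) (hs : ∀ k, 0 ≤ s k) :
    (multisphere N p s ∗ multivariateGaussian 0 (σ ^ 2 • (1 : Matrix (Fin N) (Fin N) ℝ))).map
      (fun y => ‖y‖ / σ) =
      (volume.restrict (Ioi (0 : ℝ))).withDensity
        (fun r => ENNReal.ofReal (radialDensity N σ p s r)) := by
  have := isProbabilityMeasure_multisphere hN s hp hp_sum
  rw [conv_multivariateGaussian _ hσ]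
  ext A hA
  have hpre : MeasurableSet ((fun y : EuclideanSpace ℝ (Fin N) => ‖y‖ / σ) ⁻¹' A) :=
    (by fun_prop : Measurable fun y : EuclideanSpace ℝ (Fin N) => ‖y‖ / σ) hA
  have hfint : Integrable (fun y => noisyDensity σ (multisphere N p s) y *
      A.indicator (fun _ => (1 : ℝ)) (‖y‖ / σ)) := by
    refine ((integrable_noisyDensity hσ (multisphere N p s)).indicator hpre).congr
      (.of_forall fun y => ?_)
    by_cases hy : ‖y‖ / σ ∈ A <;> simp [indicator, hy]
  rw [Measure.map_apply (by fun_prop) hA, withDensity_apply _ hpre, withDensity_apply _ hA]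
  -- The indicator of `A` serves as test function; the passage through real integrals makes the
  -- polar formula available.
  calc ∫⁻ y in (fun y => ‖y‖ / σ) ⁻¹' A, ENNReal.ofReal (noisyDensity σ (multisphere N p s) y)
      = ∫⁻ y, ENNReal.ofReal (noisyDensity σ (multisphere N p s) y *
          A.indicator (fun _ => (1 : ℝ)) (‖y‖ / σ)) := by
        rw [← lintegral_indicator hpre]
        refine lintegral_congr fun y => ?_
        by_cases hy : ‖y‖ / σ ∈ A <;> simp [indicator, hy]
    _ = ENNReal.ofReal (∫ r in Ioi (0 : ℝ), radialDensity N σ p s r *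
          A.indicator (fun _ => (1 : ℝ)) r) := by
        rw [← ofReal_integral_eq_lintegral_ofReal hfint (.of_forall fun y =>
          mul_nonneg (noisyDensity_nonneg hσ _ y) (indicator_nonneg (fun _ _ => zero_le_one) _)),
          integral_noisyDensity_mul_comp_norm hN hσ hp hs]
    _ = ∫⁻ r in Ioi (0 : ℝ), ENNReal.ofReal (radialDensity N σ p s r *
          A.indicator (fun _ => (1 : ℝ)) r) := by
        refine ofReal_integral_eq_lintegral_ofReal
          ((integrable_noisyDensity_mul_comp_norm_iff hN hσ hp hs _).1 hfint) ?_
        filter_upwards [ae_restrict_mem measurableSet_Ioi] with r hr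
        exact mul_nonneg (radialDensity_pos hN hσ hp hp_sum hs hr).le
          (indicator_nonneg (fun _ _ => zero_le_one) _)
    _ = _ := by
        rw [← lintegral_indicator hA]
        refine lintegral_congr fun r => ?_
        by_cases hr : r ∈ A <;> simp [hr]

/-! ### Output entropy as a radial integral -/

/-- The log-density of the noisy multisphere vector, as a function of the normalized radius. -/
lemma noisyDensity_mul_logb_ae (hN : 1 ≤ N) (hσ : 0 < σ) {K : ℕ} {p s : Fin K → ℝ}
    (hp : ∀ k, 0 ≤ p k) (hs : ∀ k, 0 ≤ s k) :
    (fun y : EuclideanSpace ℝ (Fin N) => noisyDensity σ (multisphere N p s) y *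
        Real.logb 2 (noisyDensity σ (multisphere N p s) y)) =ᵐ[volume]
      fun y => noisyDensity σ (multisphere N p s) y *
        (fun r => Real.logb 2 ((sphereArea N σ)⁻¹ * (radialDensity N σ p s r / r ^ (N - 1))))
          (‖y‖ / σ) := by
  filter_upwards [noisyDensity_multisphere_ae hN hσ hp hs] with y hy
  simp only [← hy]

/-- Positivity of the mixture allows the logarithm to split. Since the mixture has mass one, the
last term integrates to `log₂ S`. -/
lemma radialDensity_mul_logb (hN : 1 ≤ N) (hσ : 0 < σ) {K : ℕ} {p s : Fin K → ℝ}
    (hp : ∀ k, 0 ≤ p k) (hp_sum : ∑ k, p k = 1) (hs : ∀ k, 0 ≤ s k) {r : ℝ} (hr : 0 < r) :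
    radialDensity N σ p s r * Real.logb 2 (radialDensity N σ p s r / r ^ (N - 1)) =
      radialDensity N σ p s r *
        Real.logb 2 ((sphereArea N σ)⁻¹ * (radialDensity N σ p s r / r ^ (N - 1))) +
      Real.logb 2 (sphereArea N σ) * radialDensity N σ p s r := by
  have h1 := radialDensity_pos hN hσ hp hp_sum hs hr
  have hS := sphereArea_pos hN hσ
  rw [Real.logb_mul (by positivity) (by positivity), Real.logb_inv]
  ring

lemma integrableOn_radialDensity (hN : 1 ≤ N) (hσ : 0 < σ) {K : ℕ} {p s : Fin K → ℝ}
    (hp : ∀ k, 0 ≤ p k) (hp_sum : ∑ k, p k = 1) (hs : ∀ k, 0 ≤ s k) :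
    IntegrableOn (radialDensity N σ p s) (Ioi 0) := by
  have := isProbabilityMeasure_multisphere hN s hp hp_sum
  simpa using (integrable_noisyDensity_mul_comp_norm_iff hN hσ hp hs (fun _ => 1)).1
    (by simpa using integrable_noisyDensity hσ (multisphere N p s))

lemma integral_radialDensity (hN : 1 ≤ N) (hσ : 0 < σ) {K : ℕ} {p s : Fin K → ℝ}
    (hp : ∀ k, 0 ≤ p k) (hp_sum : ∑ k, p k = 1) (hs : ∀ k, 0 ≤ s k) :
    ∫ r in Ioi (0 : ℝ), radialDensity N σ p s r = 1 := by
  have := isProbabilityMeasure_multisphere hN s hp hp_sum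
  have h := integral_noisyDensity_mul_comp_norm hN hσ hp hs (fun _ => 1)
  simp only [mul_one] at h
  rw [← h, integral_noisyDensity hσ]

lemma integrableOn_radialDensity_mul_logb_sphereArea (hN : 1 ≤ N) (hσ : 0 < σ) {K : ℕ}
    {p s : Fin K → ℝ} (hp : ∀ k, 0 ≤ p k) (hp_sum : ∑ k, p k = 1) (hs : ∀ k, 0 ≤ s k) :
    IntegrableOn (fun r => radialDensity N σ p s r *
      Real.logb 2 ((sphereArea N σ)⁻¹ * (radialDensity N σ p s r / r ^ (N - 1)))) (Ioi 0) := by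
  have := isProbabilityMeasure_multisphere hN s hp hp_sum
  exact (integrable_noisyDensity_mul_comp_norm_iff hN hσ hp hs _).1
    ((integrable_noisyDensity_mul_logb (multisphere N p s) hσ (ae_norm_le_multisphere p hs)).congr
      (noisyDensity_mul_logb_ae hN hσ hp hs))

lemma integrableOn_radialDensity_mul_logb (hN : 1 ≤ N) (hσ : 0 < σ) {K : ℕ}
    {p s : Fin K → ℝ} (hp : ∀ k, 0 ≤ p k) (hp_sum : ∑ k, p k = 1) (hs : ∀ k, 0 ≤ s k) :
    IntegrableOn (fun r => radialDensity N σ p s r *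
      Real.logb 2 (radialDensity N σ p s r / r ^ (N - 1))) (Ioi 0) :=
  ((integrableOn_radialDensity_mul_logb_sphereArea hN hσ hp hp_sum hs).add
    ((integrableOn_radialDensity hN hσ hp hp_sum hs).const_mul
      (Real.logb 2 (sphereArea N σ)))).congr_fun
    (fun _ hr => (radialDensity_mul_logb hN hσ hp hp_sum hs hr).symm) measurableSet_Ioi

/-- The differential entropy of a multisphere vector plus Gaussian noise. -/
lemma diffEntropy_conv_multisphere (hN : 1 ≤ N) (hσ : 0 < σ) {K : ℕ} {p s : Fin K → ℝ}
    (hp : ∀ k, 0 ≤ p k) (hp_sum : ∑ k, p k = 1) (hs : ∀ k, 0 ≤ s k) :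
    diffEntropy (multisphere N p s ∗
      multivariateGaussian 0 (σ ^ 2 • (1 : Matrix (Fin N) (Fin N) ℝ))) =
      -(∫ r in Ioi (0 : ℝ), radialDensity N σ p s r *
        Real.logb 2 (radialDensity N σ p s r / r ^ (N - 1))) + Real.logb 2 (sphereArea N σ) := by
  have := isProbabilityMeasure_multisphere hN s hp hp_sum
  rw [conv_multivariateGaussian _ hσ, diffEntropy_withDensity (measurable_noisyDensity _)
    (noisyDensity_nonneg hσ _), integral_congr_ae (noisyDensity_mul_logb_ae hN hσ hp hs),
    integral_noisyDensity_mul_comp_norm hN hσ hp hs (fun r =>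
      Real.logb 2 ((sphereArea N σ)⁻¹ * (radialDensity N σ p s r / r ^ (N - 1)))),
    setIntegral_congr_fun measurableSet_Ioi
      (fun r hr => radialDensity_mul_logb hN hσ hp hp_sum hs hr),
    integral_add (integrableOn_radialDensity_mul_logb_sphereArea hN hσ hp hp_sum hs)
      ((integrableOn_radialDensity hN hσ hp hp_sum hs).const_mul _), integral_const_mul,
    integral_radialDensity hN hσ hp hp_sum hs]
  ring

/-- Both `sphereArea N σ` and the Gaussian normalizer contain `(√π * σ) ^ N`, which cancels. What
remains of the noise entropy is `N / 2` times `log₂ 2 + log₂ e`. -/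
lemma logb_sphereArea_sub (hN : 1 ≤ N) (hσ : 0 < σ) :
    Real.logb 2 (sphereArea N σ) -
      (N * Real.logb 2 (√(2 * Real.pi) * σ) + N / 2 / Real.log 2) =
    Real.logb 2 (2 / Real.Gamma ((N : ℝ) / 2)) - (N : ℝ) / 2 * Real.logb 2 (2 * Real.exp 1) := by
  have hN' : (0 : ℝ) < N := by exact_mod_cast hN
  have hG : 0 < Real.Gamma ((N : ℝ) / 2) := Real.Gamma_pos_of_pos (by positivity)
  have hpi := Real.pi_pos
  have hlog := Real.log_pos one_lt_two
  have h1 : sphereArea N σ = (√Real.pi * σ) ^ N * (2 / Real.Gamma ((N : ℝ) / 2)) := by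
    rw [sphereArea, mul_pow]; ring
  have h2 : √(2 * Real.pi) * σ = √2 * (√Real.pi * σ) := by
    rw [Real.sqrt_mul two_pos.le, mul_assoc]
  rw [h1, h2, Real.logb_mul (by positivity) (by positivity), Real.logb_pow,
    Real.logb_mul (x := √2) (by positivity) (by positivity),
    Real.logb_mul two_ne_zero (Real.exp_pos 1).ne', Real.logb_self_eq_one one_lt_two]
  simp only [Real.logb, Real.log_sqrt two_pos.le, Real.log_exp]
  field_simp
  ring

end Multisphere

theorem corollary1 {Ω : Type*} [MeasurableSpace Ω] (P : Measure Ω) [IsProbabilityMeasure P]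
    (N : ℕ) (hN : 1 ≤ N) (σ : ℝ) (hσ : 0 < σ)
    (K : ℕ) (p s : Fin K → ℝ) (hp : ∀ k, 0 ≤ p k) (hp_sum : ∑ k, p k = 1) (hs : ∀ k, 0 ≤ s k)
    (X Z : Ω → EuclideanSpace ℝ (Fin N))
    (hX : HasLaw X (Multisphere.multisphere N p s) P)
    (hZ : HasLaw Z (multivariateGaussian 0 (σ ^ 2 • (1 : Matrix (Fin N) (Fin N) ℝ))) P)
    (hXZ : IndepFun X Z P) :
    -- the entropies that define the mutual information exist and are finite
    Multisphere.HasDiffEntropy (P.map (X + Z)) ∧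
    Multisphere.HasCondDiffEntropy X (X + Z) P ∧
    -- the mixture of the `χ` is the density of the normalized output radius
    HasLaw (fun ω => ‖X ω + Z ω‖ / σ)
      ((volume.restrict (Ioi (0 : ℝ))).withDensity
        (fun r => ENNReal.ofReal (Multisphere.radialDensity N σ p s r))) P ∧
    -- the integral in the formula converges absolutely, and the formula holds
    IntegrableOn (fun r : ℝ => Multisphere.radialDensity N σ p s r *
      Real.logb 2 (Multisphere.radialDensity N σ p s r / r ^ (N - 1))) (Ioi (0 : ℝ)) ∧
    Multisphere.mutualInfo X (X + Z) P =
      -(∫ r in Ioi (0 : ℝ), Multisphere.radialDensity N σ p s r *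
          Real.logb 2 (Multisphere.radialDensity N σ p s r / r ^ (N - 1)))
        + Real.logb 2 (2 / Real.Gamma ((N : ℝ) / 2))
        - (N : ℝ) / 2 * Real.logb 2 (2 * Real.exp 1) := by
  have := Multisphere.isProbabilityMeasure_multisphere hN s hp hp_sum
  have hsum : P.map (X + Z) = Multisphere.multisphere N p s ∗
      multivariateGaussian 0 (σ ^ 2 • (1 : Matrix (Fin N) (Fin N) ℝ)) := by
    rw [hXZ.map_add_eq_map_conv_map₀ hX.aemeasurable hZ.aemeasurable, hX.map_eq, hZ.map_eq]
  have hcond := Multisphere.condDistrib_add_of_indepFun hX.aemeasurable hZ.aemeasurable hXZ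
  rw [hZ.map_eq] at hcond
  have hXprob := Measure.isProbabilityMeasure_map (μ := P) hX.aemeasurable
  -- Entropy is translation invariant, so the conditional entropy does not depend on the input value
  -- and its average is immediate.
  have hcondEnt : (fun x => Multisphere.diffEntropy (condDistrib (X + Z) X P x)) =ᵐ[P.map X]
      fun _ => N * Real.logb 2 (√(2 * Real.pi) * σ) + N / 2 / Real.log 2 := by
    filter_upwards [hcond] with x hx
    rw [hx, Multisphere.diffEntropy_dirac_conv hσ]
  refine ⟨?_, ⟨?_, (integrable_const _).congr hcondEnt.symm⟩, ⟨?_, ?_⟩,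
    Multisphere.integrableOn_radialDensity_mul_logb hN hσ hp hp_sum hs, ?_⟩
  · rw [hsum, Multisphere.conv_multivariateGaussian _ hσ]
    exact Multisphere.hasDiffEntropy_withDensity (Multisphere.measurable_noisyDensity _)
      (Multisphere.noisyDensity_nonneg hσ _)
      (Multisphere.integrable_noisyDensity_mul_logb _ hσ (Multisphere.ae_norm_le_multisphere p hs))
  · filter_upwards [hcond] with x hx
    rw [hx]
    exact Multisphere.hasDiffEntropy_dirac_conv hσ x
  · have := hX.aemeasurable
    have := hZ.aemeasurable
    fun_prop
  · rw [← Multisphere.map_norm_div_conv_multisphere hN hσ hp hp_sum hs, ← hsum,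
      AEMeasurable.map_map_of_aemeasurable (by fun_prop) (hX.aemeasurable.add hZ.aemeasurable)]
    rfl
  · rw [Multisphere.mutualInfo, Multisphere.condDiffEntropy, integral_congr_ae hcondEnt, hsum,
      Multisphere.diffEntropy_conv_multisphere hN hσ hp hp_sum hs, integral_const, probReal_univ,
      one_smul]
    linarith [Multisphere.logb_sphereArea_sub hN hσ]
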